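/- Rings are associative with identity and not necessarily commutative. A ring homomorphism $f:R\to S$ is a ring epimorphism if for all rings $T$ and ring homomorphisms $\alpha,\beta:S\to T$, $\alpha f=\beta f$ implies $\alpha=\beta$; via $f$, $S$ is a left $R$-module ($r\cdot s=f(r)s$) and a right $R$-module ($s\cdot r=sf(r)$). For every ring $R$ there exist a ring $Q^\sigma_{tot}(R)$ (the total symmetric ring of quotients of $R$) and an injective ring epimorphism $f:R\to Q^\sigma_{tot}(R)$ such that: (1) $f$ makes $Q^\sigma_{tot}(R)$ a flat left $R$-module and a flat right $R$-module; (2) if $g:R\to S$ is an injective ring epimorphism that makes $S$ a flat left $R$-module and a flat right $R$-module, then there is a unique injective ring homomorphism $\bar g:S\to Q^\sigma_{tot}(R)$ with $f=\bar g\circ g$. -/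

import Mathlib

open scoped TensorProduct

universe u v

namespace NCRing

section Tensor

variable (R : Type*) [Ring R]
  (M : Type*) [AddCommGroup M] [Module Rᵐᵒᵖ M]
  (N : Type*) [AddCommGroup N] [Module R N]

/-- The subgroup of `M ⊗[ℤ] N` generated by the elements `(m · r) ⊗ n - m ⊗ (r · n)`, for a right
`R`-module `M` (that is, an `Rᵐᵒᵖ`-module) and a left `R`-module `N`. -/
def balancingRelations : AddSubgroup (M ⊗[ℤ] N) :=
  AddSubgroup.closure
    {x | ∃ (m : M) (r : R) (n : N), x = (MulOpposite.op r • m) ⊗ₜ[ℤ] n - m ⊗ₜ[ℤ] (r • n)}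

/-- The tensor product `M ⊗_R N` (an abelian group) of a right module `M` and a left module `N`
over an arbitrary ring `R`. -/
abbrev BalancedTensor : Type _ := (M ⊗[ℤ] N) ⧸ balancingRelations R M N

end Tensor

/-- The homomorphism `i ⊗ j : M ⊗_R N → M' ⊗_R N'`, `m ⊗ n ↦ i m ⊗ j n`, induced by a homomorphism
`i` of right modules and a homomorphism `j` of left modules. -/
def BalancedTensor.map {R : Type*} [Ring R]
    {M M' : Type*} [AddCommGroup M] [Module Rᵐᵒᵖ M] [AddCommGroup M'] [Module Rᵐᵒᵖ M']
    {N N' : Type*} [AddCommGroup N] [Module R N] [AddCommGroup N'] [Module R N']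
    (i : M →ₗ[Rᵐᵒᵖ] M') (j : N →ₗ[R] N') :
    BalancedTensor R M N →+ BalancedTensor R M' N' :=
  QuotientAddGroup.map (balancingRelations R M N) (balancingRelations R M' N')
    (TensorProduct.map i.toAddMonoidHom.toIntLinearMap
      j.toAddMonoidHom.toIntLinearMap).toAddMonoidHom
    (by
      refine (AddSubgroup.closure_le _).2 ?_
      rintro _ ⟨m, r, n, rfl⟩
      exact AddSubgroup.subset_closure ⟨i m, r, j n, by simp⟩)

/-- A left `R`-module `N` is flat if `- ⊗_R N` preserves injectivity of homomorphisms of right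
`R`-modules. The test modules live in the universe of `R`; since it suffices to test the inclusions
of right ideals into `R`, this is the same as testing modules of all universes. -/
def IsLeftFlat (R : Type u) [Ring R] (N : Type v) [AddCommGroup N] [Module R N] : Prop :=
  ∀ (M M' : Type u) [AddCommGroup M] [Module Rᵐᵒᵖ M] [AddCommGroup M'] [Module Rᵐᵒᵖ M']
    (i : M →ₗ[Rᵐᵒᵖ] M'), Function.Injective i →
      Function.Injective (BalancedTensor.map i (LinearMap.id : N →ₗ[R] N))

/-- A right `R`-module `M` is flat if `M ⊗_R -` preserves injectivity of homomorphisms of left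
`R`-modules. -/
def IsRightFlat (R : Type u) [Ring R] (M : Type v) [AddCommGroup M] [Module Rᵐᵒᵖ M] : Prop :=
  ∀ (N N' : Type u) [AddCommGroup N] [Module R N] [AddCommGroup N'] [Module R N']
    (j : N →ₗ[R] N'), Function.Injective j →
      Function.Injective (BalancedTensor.map (LinearMap.id : M →ₗ[Rᵐᵒᵖ] M) j)

variable {R : Type u} [Ring R] {S : Type v} [Ring S]

/-- `f : R → S` makes `S` a flat left `R`-module, the action being `r · s = f(r) s`. -/
def MakesLeftFlat (f : R →+* S) : Prop :=
  letI : Module R S := Module.compHom S f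
  IsLeftFlat R S

/-- `f : R → S` makes `S` a flat right `R`-module, the action being `s · r = s f(r)`. -/
def MakesRightFlat (f : R →+* S) : Prop :=
  letI : Module Rᵐᵒᵖ S := Module.compHom S (RingHom.op f)
  IsRightFlat R S

/-- `f : R → S` is a ring epimorphism: it is right cancellable against ring homomorphisms out
of `S`. The target rings `T` live in the universe of `S`; this is no restriction, as one may replace
`T` by the subring generated by the images of two given homomorphisms `S → T`. -/
def IsRingEpi (f : R →+* S) : Prop :=
  ∀ (T : Type v) [Ring T] (g h : S →+* T), g.comp f = h.comp f → g = h

end NCRing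

/-!
Call `t` in `R` a denominator of an element `s` of an extension `f : R → S` if `s f(t) ∈ f(R)`. The
proof replaces the condition "flat epimorphism" by an elementary one: the denominators of each
element of `S` generate `S` as a right ideal, so that `1 = ∑ f(tᵢ) bᵢ` with `s f(tᵢ) ∈ f(R)`
(`covered f = ⊤`). For injective `f` this holds if and only if `f` is an epimorphism that makes `S`
a flat left module:

* Given a flat epimorphism, the character module `S⋆ = Hom(S, ℚ/ℤ)` is an injective right
  `R`-module (`IsLeftFlat.baer_characterModule`), and `R`-linear maps between `S`-modules are
  `S`-linear (`IsRingEpi.map_smul`). If the denominators of `s` generated a proper right ideal, a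
  character vanishing on it would yield, by injectivity, a nonzero `R`-linear map `S → S⋆` that
  vanishes on `R`, contrary to `S`-linearity (`IsRingEpi.covered_eq_top`).
* Conversely, two homomorphisms on `S` that agree on `R` agree after multiplication by denominators,
  hence everywhere (`eq_of_comp_eq`), and an element of `M ⊗_R S` is moved into `M` by common
  denominators, which reduces flatness to the injectivity of `M → M'`
  (`makesLeftFlat_of_covered_eq_top`).

The statements for right modules follow by passing to opposite rings (`makesRightFlat_iff_op`).

The condition makes the right ideal of denominators of each `s` dense, so left multiplication by `s`
is an element of the maximal right ring of quotients of `R`, and `S` embeds into that ring over `R`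
(`MaxQuotient.embed`). The elements that have generating denominators form a subring (`covered`), so
the subring generated by all two-sided flat epimorphic extensions of `R` inside the maximal ring of
quotients is again one of them (`isTwoSidedCovered_toTotal`). It is the total symmetric ring of
quotients.
-/

universe w

namespace NCRing

/-! ### Elements with a generating ideal of denominators -/

section Covered

variable {R : Type*} [Ring R] {S : Type*} [Ring S] {T : Type*} [Ring T]

/-- The images under `f : R → S` of the elements of `A` generate `S` as a right ideal, that is,
`1 = ∑ f(aᵢ) bᵢ` for some `aᵢ ∈ A` and `bᵢ ∈ S`. -/
def Generates (f : R →+* S) (A : Set R) : Prop :=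
  (1 : S) ∈ Submodule.span Sᵐᵒᵖ (f '' A)

namespace Generates

variable {f : R →+* S} {A B : Set R}

lemma of_one_mem (h : 1 ∈ A) : Generates f A :=
  Submodule.subset_span ⟨1, h, map_one f⟩

lemma mono (h : Generates f A) (hAB : A ⊆ B) : Generates f B :=
  Submodule.span_mono (Set.image_mono hAB) h

lemma mem_of_forall_mul_mem (h : Generates f A) {P : Submodule Sᵐᵒᵖ S} {x : S}
    (hP : ∀ a ∈ A, x * f a ∈ P) : x ∈ P := by
  have hle : Submodule.span Sᵐᵒᵖ (f '' A) ≤ P.comap (DistribSMul.toLinearMap Sᵐᵒᵖ S x) := by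
    rw [Submodule.span_le]
    rintro _ ⟨a, ha, rfl⟩
    exact hP a ha
  simpa using hle h

lemma eq_zero (h : Generates f A) {x : S} (hx : ∀ a ∈ A, x * f a = 0) : x = 0 := by
  simpa using h.mem_of_forall_mul_mem (P := ⊥) (x := x) (by simpa using hx)

lemma trans (h : Generates f A) (hB : ∀ a ∈ A, Generates f {t | a * t ∈ B}) : Generates f B := by
  refine h.mem_of_forall_mul_mem fun a ha => (hB a ha).mem_of_forall_mul_mem fun t ht => ?_
  rw [one_mul, ← map_mul]
  exact Submodule.subset_span ⟨a * t, ht, rfl⟩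

lemma map (h : Generates f A) (k : S →+* T) : Generates (k.comp f) A := by
  suffices ∀ x ∈ Submodule.span Sᵐᵒᵖ (f '' A), k x ∈ Submodule.span Tᵐᵒᵖ (k.comp f '' A) by
    simpa [Generates] using this 1 h
  intro x hx
  induction hx using Submodule.span_induction with
  | mem x hx =>
    obtain ⟨a, ha, rfl⟩ := hx
    exact Submodule.subset_span ⟨a, ha, rfl⟩
  | zero => simp
  | add x y _ _ hx hy => simpa using add_mem hx hy
  | smul s x _ hx => simpa using Submodule.smul_mem _ (MulOpposite.op (k s.unop)) hx

end Generates

/-- The elements `s` of `S` such that, for every `c` in `R`, the elements `t` of `R` with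
`s f(c) f(t) ∈ f(R)` generate `S` as a right ideal. Quantifying over `c` makes this set closed under
multiplication. -/
def covered (f : R →+* S) : Subring S where
  carrier := {s | ∀ c, Generates f {t | s * f (c * t) ∈ f.range}}
  mul_mem' {x y} hx hy c := by
    refine (hy c).trans fun r hr => ?_
    obtain ⟨d, hd⟩ := hr
    refine (hx d).mono fun t ht => ?_
    rwa [Set.mem_ofPred_eq, map_mul, hd, mul_assoc, ← map_mul, ← mul_assoc, mul_assoc c] at ht
  one_mem' c := .of_one_mem (by simp)
  add_mem' {x y} hx hy c := by
    refine (hx c).trans fun r hr => (hy (c * r)).mono fun t ht => ?_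
    have : x * f (c * (r * t)) ∈ f.range := by
      rw [← mul_assoc, map_mul, ← mul_assoc]
      exact mul_mem hr ⟨t, rfl⟩
    rw [Set.mem_ofPred_eq, mul_assoc] at ht
    simpa [add_mul] using add_mem this ht
  zero_mem' c := .of_one_mem (by simp)
  neg_mem' {x} hx c := (hx c).mono fun t ht => by
    simpa using neg_mem (show x * f (c * t) ∈ f.range from ht)

lemma mem_covered {f : R →+* S} (hf : covered f = ⊤) (s : S) : s ∈ covered f :=
  hf ▸ Subring.mem_top s

lemma map_mem_covered {f : R →+* S} {s : S} (hs : s ∈ covered f) (k : S →+* T) :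
    k s ∈ covered (k.comp f) := fun c =>
  ((hs c).map k).mono fun t ⟨r, hr⟩ => ⟨r, by simp [hr]⟩

/-- Every finite set of covered elements has a generating set of common denominators. -/
lemma generates_commonDenominators {f : R →+* S} (hf : covered f = ⊤) (F : Finset S) :
    Generates f {t | ∀ s ∈ F, s * f t ∈ f.range} := by
  classical
  induction F using Finset.induction_on with
  | empty => exact .of_one_mem (by simp)
  | insert s F _ ih =>
    refine ih.trans fun a ha => ?_
    refine (mem_covered hf s a).mono fun t ht => ?_
    simp only [Set.mem_ofPred_eq, Finset.mem_insert, forall_eq_or_imp]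
    refine ⟨ht, fun s' hs' => ?_⟩
    rw [map_mul, ← mul_assoc]
    exact mul_mem (ha s' hs') ⟨t, rfl⟩

/-- Homomorphisms that agree on `R` agree on `S`: they agree after right multiplication by the
denominators of an element, and these generate. The target may live in any universe. -/
lemma eq_of_comp_eq {f : R →+* S} (hf : covered f = ⊤) {g h : S →+* T}
    (hgh : g.comp f = h.comp f) : g = h := by
  have hgh' (r : R) : g (f r) = h (f r) := RingHom.congr_fun hgh r
  ext s
  refine sub_eq_zero.1 ((mem_covered hf s 1).map g |>.eq_zero ?_)
  rintro t ⟨r, hr⟩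
  have h1 := congrArg g hr
  have h2 := congrArg h hr
  simp only [one_mul, map_mul] at h1 h2
  rw [sub_mul, RingHom.comp_apply, ← h1, hgh', hgh', ← h2, sub_self]

lemma isRingEpi_of_covered_eq_top {R : Type u} [Ring R] {S : Type v} [Ring S] {f : R →+* S}
    (hf : covered f = ⊤) : IsRingEpi f :=
  fun _ _ _ _ hgh => eq_of_comp_eq hf hgh

end Covered

/-! ### Ring epimorphisms -/

section Epi

variable {R : Type u} [Ring R] {S : Type v} [Ring S] {f : R →+* S}

lemma IsRingEpi.op (hf : IsRingEpi f) : IsRingEpi (RingHom.op f) := by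
  intro T _ g h hgh
  let o (k : Sᵐᵒᵖ →+* T) : S →+* Tᵐᵒᵖ := RingHom.unop ((RingEquiv.opOp T).toRingHom.comp k)
  have h' : o g = o h := hf Tᵐᵒᵖ _ _ <| RingHom.ext fun r =>
    congrArg MulOpposite.op (RingHom.congr_fun hgh (MulOpposite.op r))
  exact RingHom.ext fun s => congrArg MulOpposite.unop (RingHom.congr_fun h' s.unop)

/-- Along a ring epimorphism `R → S`, the `R`-linear maps between `S`-modules are `S`-linear:
conjugating the action of `S` on `X × Y` by the automorphism `(x, y) ↦ (x, y + h x)` does not change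
the action of `R`. -/
lemma IsRingEpi.map_smul (hf : IsRingEpi f) {X Y : Type v} [AddCommGroup X] [Module S X]
    [AddCommGroup Y] [Module S Y] (h : X →+ Y) (hh : ∀ r x, h (f r • x) = f r • h x)
    (s : S) (x : X) : h (s • x) = s • h x := by
  let α : S →+* AddMonoid.End (X × Y) := Module.toAddMonoidEnd S (X × Y)
  let e : AddMonoid.End (X × Y) :=
    (AddMonoidHom.fst X Y).prod (AddMonoidHom.snd X Y + h.comp (AddMonoidHom.fst X Y))
  let e' : AddMonoid.End (X × Y) :=
    (AddMonoidHom.fst X Y).prod (AddMonoidHom.snd X Y - h.comp (AddMonoidHom.fst X Y))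
  have he (z : X × Y) : e z = (z.1, z.2 + h z.1) := rfl
  have he' (z : X × Y) : e' z = (z.1, z.2 - h z.1) := rfl
  have hα (s : S) (z : X × Y) : α s z = (s • z.1, s • z.2) := rfl
  have hee' : e * e' = 1 := by
    refine DFunLike.ext _ _ fun z => ?_
    change e (e' z) = z
    simp [he, he']
  have he'e : e' * e = 1 := by
    refine DFunLike.ext _ _ fun z => ?_
    change e' (e z) = z
    simp [he, he']
  let β : S →+* AddMonoid.End (X × Y) :=
    { toFun := fun s => e * α s * e'
      map_one' := by rw [map_one, mul_one, hee']
      map_mul' := fun a b => by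
        rw [map_mul]
        calc e * (α a * α b) * e' = e * α a * 1 * α b * e' := by noncomm_ring
          _ = e * α a * e' * (e * α b * e') := by rw [← he'e]; noncomm_ring
      map_zero' := by simp
      map_add' := fun a b => by rw [map_add, mul_add, add_mul] }
  have hβ (s : S) (z : X × Y) : β s z = e (α s (e' z)) := rfl
  have hαβ : α = β := by
    refine hf _ α β (RingHom.ext fun r => DFunLike.ext _ _ fun z => ?_)
    simp only [RingHom.comp_apply, hβ, hα, he, he']
    simp [hh, smul_sub]
  have := congrArg Prod.snd (DFunLike.congr_fun (RingHom.congr_fun hαβ s) (x, 0))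
  simp only [hβ, hα, he, he', smul_zero, zero_sub, smul_neg] at this
  exact (neg_add_eq_zero.1 this.symm).symm

end Epi

/-! ### Balanced tensor products -/

namespace BalancedTensor

variable {R : Type*} [Ring R]
  {M : Type*} [AddCommGroup M] [Module Rᵐᵒᵖ M] {M' : Type*} [AddCommGroup M'] [Module Rᵐᵒᵖ M']
  {N : Type*} [AddCommGroup N] [Module R N] {N' : Type*} [AddCommGroup N'] [Module R N']
  {P : Type*} [AddCommGroup P]

variable (R) in
/-- The pure tensor `m ⊗ n` in `M ⊗_R N`, as a biadditive map. -/
def tmul : M →+ N →+ BalancedTensor R M N where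
  toFun m :=
    { toFun := fun n => QuotientAddGroup.mk (m ⊗ₜ[ℤ] n)
      map_zero' := by rw [TensorProduct.tmul_zero]; rfl
      map_add' := fun n n' => by rw [TensorProduct.tmul_add]; rfl }
  map_zero' := by ext n; simp
  map_add' m m' := by ext n; simp [TensorProduct.add_tmul]

lemma tmul_smul (m : M) (r : R) (n : N) :
    tmul R (MulOpposite.op r • m) n = tmul R m (r • n) := by
  rw [← sub_eq_zero]
  exact (QuotientAddGroup.eq_zero_iff _).2 (AddSubgroup.subset_closure ⟨m, r, n, rfl⟩)

@[simp] lemma map_tmul (i : M →ₗ[Rᵐᵒᵖ] M') (j : N →ₗ[R] N') (m : M) (n : N) :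
    map i j (tmul R m n) = tmul R (i m) (j n) := rfl

@[elab_as_elim]
lemma induction {p : BalancedTensor R M N → Prop} (x : BalancedTensor R M N)
    (zero : p 0) (tmul : ∀ m n, p (tmul R m n)) (add : ∀ x y, p x → p y → p (x + y)) : p x := by
  induction x using QuotientAddGroup.induction_on with | H x => ?_
  induction x using TensorProduct.induction_on with
  | zero => exact zero
  | tmul m n => exact tmul m n
  | add x y hx hy => exact add _ _ hx hy

/-- The homomorphism `M ⊗_R N → P` induced by a biadditive balanced map. -/
def lift (φ : M →+ N →+ P) (hφ : ∀ m (r : R) n, φ (MulOpposite.op r • m) n = φ m (r • n)) :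
    BalancedTensor R M N →+ P :=
  QuotientAddGroup.lift _
    (TensorProduct.liftAddHom φ fun r m n => by simp : M ⊗[ℤ] N →+ P) <| by
    refine (AddSubgroup.closure_le _).2 ?_
    rintro _ ⟨m, r, n, rfl⟩
    simp [hφ]

@[simp] lemma lift_tmul (φ : M →+ N →+ P)
    (hφ : ∀ m (r : R) n, φ (MulOpposite.op r • m) n = φ m (r • n)) (m : M) (n : N) :
    lift φ hφ (tmul R m n) = φ m n := rfl

lemma hom_ext {φ ψ : BalancedTensor R M N →+ P} (h : ∀ m n, φ (tmul R m n) = ψ (tmul R m n)) :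
    φ = ψ := by
  refine AddMonoidHom.ext fun x => ?_
  induction x using induction with
  | zero => simp
  | tmul m n => exact h m n
  | add x y hx hy => simp [hx, hy]

section Swap

variable {L : Type*} [AddCommGroup L] [Module Rᵐᵒᵖ L]
  {L' : Type*} [AddCommGroup L'] [Module Rᵐᵒᵖ L']
  [Module Rᵐᵒᵖᵐᵒᵖ N] [Module Rᵐᵒᵖᵐᵒᵖ N']

/-- The isomorphism `L ⊗_R N ≃ N ⊗_{Rᵒᵖ} L`, where `L` may be replaced by an isomorphic copy. -/
def swap (e : L ≃+ L') (he : ∀ (a : Rᵐᵒᵖ) l, e (a • l) = a • e l)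
    (hN : ∀ (r : R) (n : N), MulOpposite.op (MulOpposite.op r) • n = r • n) :
    BalancedTensor R L N ≃+ BalancedTensor Rᵐᵒᵖ N L' :=
  AddMonoidHom.toAddEquiv
    (lift ((tmul Rᵐᵒᵖ (M := N) (N := L')).flip.comp e.toAddMonoidHom) fun l r n => by
      simp [he, ← hN, tmul_smul])
    (lift ((tmul R (M := L) (N := N)).comp e.symm.toAddMonoidHom).flip fun n a l => by
      have : e.symm (a • l) = a • e.symm l := e.injective (by simp [he])
      obtain ⟨r, rfl⟩ := MulOpposite.op_surjective a
      simp [this, hN, tmul_smul])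
    (hom_ext fun l n => by simp)
    (hom_ext fun l n => by simp)

lemma injective_map_iff_of_swap (e : L ≃+ L') (he : ∀ (a : Rᵐᵒᵖ) l, e (a • l) = a • e l)
    (hN : ∀ (r : R) (n : N), MulOpposite.op (MulOpposite.op r) • n = r • n)
    (hN' : ∀ (r : R) (n : N'), MulOpposite.op (MulOpposite.op r) • n = r • n)
    (j : N →ₗ[R] N') (i : N →ₗ[Rᵐᵒᵖᵐᵒᵖ] N') (hij : ∀ n, i n = j n) :
    Function.Injective (map (LinearMap.id : L →ₗ[Rᵐᵒᵖ] L) j) ↔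
      Function.Injective (map i (LinearMap.id : L' →ₗ[Rᵐᵒᵖ] L')) := by
  have h : (swap e he hN').toAddMonoidHom.comp (map (LinearMap.id : L →ₗ[Rᵐᵒᵖ] L) j) =
      (map i (LinearMap.id : L' →ₗ[Rᵐᵒᵖ] L')).comp (swap e he hN).toAddMonoidHom :=
    hom_ext fun l n => by simp [swap, hij]
  have h' : swap e he hN' ∘ map (LinearMap.id : L →ₗ[Rᵐᵒᵖ] L) j =
      map i (LinearMap.id : L' →ₗ[Rᵐᵒᵖ] L') ∘ swap e he hN := congrArg DFunLike.coe h
  rw [← (swap e he hN').injective.of_comp_iff, h',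
    Function.Injective.of_comp_iff' _ (swap e he hN).bijective]

end Swap

end BalancedTensor

section Opposite

variable {R : Type u} [Ring R] {S : Type v} [Ring S] {f : R →+* S}

lemma makesRightFlat_iff_op : MakesRightFlat f ↔ MakesLeftFlat (RingHom.op f) := by
  let _ : Module Rᵐᵒᵖ S := Module.compHom S (RingHom.op f)
  let _ : Module Rᵐᵒᵖ Sᵐᵒᵖ := Module.compHom Sᵐᵒᵖ (RingHom.op f)
  have he (a : Rᵐᵒᵖ) (s : S) : MulOpposite.opAddEquiv (a • s) = a • MulOpposite.opAddEquiv s := rfl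
  constructor
  · intro h M M' _ _ _ _ i hi
    let _ : Module R M := Module.compHom M (RingEquiv.opOp R).toRingHom
    let _ : Module R M' := Module.compHom M' (RingEquiv.opOp R).toRingHom
    let j : M →ₗ[R] M' :=
      { toFun := i, map_add' := map_add i, map_smul' := fun r m => map_smul i (RingEquiv.opOp R r) m }
    exact (BalancedTensor.injective_map_iff_of_swap MulOpposite.opAddEquiv he (fun _ _ => rfl)
      (fun _ _ => rfl) j i fun _ => rfl).1 (h M M' j hi)
  · intro h N N' _ _ _ _ j hj
    let _ : Module Rᵐᵒᵖᵐᵒᵖ N := Module.compHom N (RingEquiv.opOp R).symm.toRingHom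
    let _ : Module Rᵐᵒᵖᵐᵒᵖ N' := Module.compHom N' (RingEquiv.opOp R).symm.toRingHom
    let i : N →ₗ[Rᵐᵒᵖᵐᵒᵖ] N' :=
      { toFun := j, map_add' := map_add j,
        map_smul' := fun r n => map_smul j ((RingEquiv.opOp R).symm r) n }
    exact (BalancedTensor.injective_map_iff_of_swap MulOpposite.opAddEquiv he (fun _ _ => rfl)
      (fun _ _ => rfl) j i fun _ => rfl).2 (h N N' i hj)

end Opposite

/-! ### Flatness and injectivity of the character module -/

section Character

variable {R : Type u} [Ring R] {N : Type v} [AddCommGroup N] [Module R N]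

/-- The character module `Hom(N, ℚ/ℤ)` of a left `R`-module is a right `R`-module,
by `(χ · r)(n) = χ(r n)`. -/
instance : Module Rᵐᵒᵖ (CharacterModule N) where
  smul a χ := AddMonoidHom.comp χ (DistribSMul.toAddMonoidHom N a.unop)
  one_smul χ := CharacterModule.ext _ fun n => congrArg χ (one_smul R n)
  mul_smul a b χ := CharacterModule.ext _ fun n => congrArg χ (mul_smul b.unop a.unop n)
  smul_zero _ := rfl
  smul_add _ _ _ := rfl
  add_smul a b χ := CharacterModule.ext _ fun n =>
    (congrArg χ (add_smul a.unop b.unop n)).trans (map_add χ _ _)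
  zero_smul χ := CharacterModule.ext _ fun n => (congrArg χ (zero_smul R n)).trans (map_zero χ)

@[simp] lemma op_smul_character_apply (a : Rᵐᵒᵖ) (χ : CharacterModule N) (n : N) :
    (a • χ) n = χ (a.unop • n) := rfl

/-- The character module of a flat module satisfies Baer's criterion. This makes it injective with
respect to modules of all universes. -/
lemma IsLeftFlat.baer_characterModule (h : IsLeftFlat R N) :
    Module.Baer Rᵐᵒᵖ (CharacterModule N) := by
  intro I g
  let i : I →ₗ[Rᵐᵒᵖ] Rᵐᵒᵖ := I.subtype
  let χ : CharacterModule (BalancedTensor R I N) :=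
    BalancedTensor.lift (P := AddCircle (1 : ℚ)) g.toAddMonoidHom fun m r n => by
      change g (MulOpposite.op r • m) n = g m (r • n)
      rw [map_smul]; rfl
  obtain ⟨ψ, hψ⟩ := CharacterModule.dual_surjective_of_injective
    (BalancedTensor.map i (LinearMap.id : N →ₗ[R] N)).toIntLinearMap
    (h I Rᵐᵒᵖ i Subtype.val_injective) χ
  let g' : Rᵐᵒᵖ →ₗ[Rᵐᵒᵖ] CharacterModule N :=
    { toFun := fun a => AddMonoidHom.comp ψ (BalancedTensor.tmul R a)
      map_add' := fun a b => CharacterModule.ext _ fun n => by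
        change ψ (BalancedTensor.tmul R (a + b) n) =
          ψ (BalancedTensor.tmul R a n) + ψ (BalancedTensor.tmul R b n)
        rw [← map_add, map_add, AddMonoidHom.add_apply]
      map_smul' := fun a b => CharacterModule.ext _ fun n => 
        congrArg ψ (BalancedTensor.tmul_smul b a.unop n) }
  refine ⟨g', fun a ha => CharacterModule.ext _ fun n => ?_⟩
  exact DFunLike.congr_fun hψ (BalancedTensor.tmul R (⟨a, ha⟩ : I) n)

end Character

/-! ### Flat epimorphisms and denominators -/

section Flat

variable {R : Type u} [Ring R] {S : Type v} [Ring S] {f : R →+* S}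

/-- If the denominators of `s` did not generate `S`, some character `χ ≠ 0` of `S` would vanish on
the right ideal they generate. By injectivity of the character module `S⋆`, the map
`s · r ↦ χ (r · -)` would extend to an `R`-linear map `S → S⋆` vanishing on `R`. Such a map is
`S`-linear and vanishes at `1`, so it is zero. -/
lemma IsRingEpi.covered_eq_top (hf : IsRingEpi f) (hflat : MakesLeftFlat f) :
    covered f = ⊤ := by
  refine eq_top_iff.2 fun s _ c => ?_
  let _ : Module R S := Module.compHom S f
  let _ : Module Rᵐᵒᵖ S := Module.compHom S (RingHom.op f)
  have hbaer : Module.Baer Rᵐᵒᵖ (CharacterModule S) := IsLeftFlat.baer_characterModule hflat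
  set A : Set R := {t | s * f (c * t) ∈ f.range} with hA
  set J : Submodule Sᵐᵒᵖ S := Submodule.span Sᵐᵒᵖ (f '' A) with hJ
  by_contra hgen
  obtain ⟨χ₀, hχ₀⟩ := CharacterModule.exists_character_apply_ne_zero_of_ne_zero
    (a := J.mkQ 1) (fun h => hgen ((Submodule.Quotient.mk_eq_zero J).1 h))
  let χ : CharacterModule S := AddMonoidHom.comp χ₀ J.mkQ.toAddMonoidHom
  have hχ (y : S) (hy : y ∈ J) : χ y = 0 :=
    (congrArg χ₀ ((Submodule.Quotient.mk_eq_zero J).2 hy)).trans (map_zero χ₀)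
  let B : Submodule Rᵐᵒᵖ S := LinearMap.range (LinearMap.toSpanSingleton Rᵐᵒᵖ S 1)
  have hB (y : S) : y ∈ B ↔ y ∈ f.range := by
    constructor
    · rintro ⟨a, rfl⟩
      exact ⟨a.unop, (one_mul _).symm⟩
    · rintro ⟨r, rfl⟩
      exact ⟨MulOpposite.op r, one_mul _⟩
  let φ := LinearMap.toSpanSingleton Rᵐᵒᵖ (S ⧸ B) (B.mkQ (s * f c))
  let ψ := LinearMap.toSpanSingleton Rᵐᵒᵖ (CharacterModule S) χ
  have hker : LinearMap.ker φ ≤ LinearMap.ker ψ := by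
    intro a ha
    have hmem : s * f c * f a.unop ∈ B := (Submodule.Quotient.mk_eq_zero B).1 ha
    rw [hB, mul_assoc, ← map_mul] at hmem
    refine CharacterModule.ext _ fun y => hχ _ ?_
    exact J.smul_mem (MulOpposite.op y) (Submodule.subset_span ⟨a.unop, hmem, rfl⟩)
  obtain ⟨h, hh⟩ := hbaer.extension_property ((LinearMap.ker φ).liftQ φ le_rfl)
    (LinearMap.ker_eq_bot.1 (Submodule.ker_liftQ_eq_bot' _ _ rfl)) ((LinearMap.ker φ).liftQ ψ hker)
  let H : S →+ CharacterModule S := (h ∘ₗ B.mkQ).toAddMonoidHom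
  have hlin (x : Sᵐᵒᵖ) (y : S) : H (x • y) = x • H y :=
    hf.op.map_smul H (fun r y => _root_.map_smul (h ∘ₗ B.mkQ) r y) x y
  have hone : H 1 = 0 := by
    have : B.mkQ 1 = 0 := (Submodule.Quotient.mk_eq_zero B).2 ((hB 1).2 (one_mem _))
    exact (congrArg h this).trans (map_zero h)
  have hs : H (s * f c) = χ := by
    have : h ((1 : Rᵐᵒᵖ) • B.mkQ (s * f c)) = (1 : Rᵐᵒᵖ) • χ :=
      LinearMap.congr_fun hh ((LinearMap.ker φ).mkQ 1)
    rwa [one_smul, one_smul] at this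
  have : χ = 0 := by
    rw [← hs, ← one_mul (s * f c), ← op_smul_eq_mul, hlin, hone, smul_zero]
  exact hχ₀ (DFunLike.congr_fun this (1 : S))

/-- The functions `R → M` that vanish on the common denominators of some finite subset of `S`. -/
def vanishing (f : R →+* S) (M : Type w) [AddCommGroup M] : AddSubgroup (R → M) where
  carrier := {φ | ∃ F : Finset S, ∀ t, (∀ s ∈ F, s * f t ∈ f.range) → φ t = 0}
  zero_mem' := ⟨∅, fun _ _ => rfl⟩
  add_mem' := by
    classical
    rintro φ ψ ⟨F, hF⟩ ⟨G, hG⟩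
    refine ⟨F ∪ G, fun t ht => ?_⟩
    rw [Pi.add_apply, hF t fun s hs => ht s (Finset.mem_union_left _ hs),
      hG t fun s hs => ht s (Finset.mem_union_right _ hs), add_zero]
  neg_mem' := by
    rintro φ ⟨F, hF⟩
    exact ⟨F, fun t ht => by rw [Pi.neg_apply, hF t ht, neg_zero]⟩

/-- The map `M ⊗_R S → (R → M) / vanishing`, sending `m ⊗ s` to the class of `t ↦ m · (s t)`, which
makes sense for the denominators `t` of `s`. Since `Function.invFun` picks preimages under `f`, the
values at other `t` are arbitrary, but they do not affect the class. -/
lemma exists_germHom (hinj : Function.Injective f) (M : Type w) [AddCommGroup M] [Module Rᵐᵒᵖ M] :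
    letI : Module R S := Module.compHom S f
    ∃ Φ : BalancedTensor R M S →+ (R → M) ⧸ vanishing f M, ∀ m s, Φ (BalancedTensor.tmul R m s) =
      QuotientAddGroup.mk fun t => MulOpposite.op (Function.invFun f (s * f t)) • m := by
  let _ : Module R S := Module.compHom S f
  have hinv (r : R) : Function.invFun f (f r) = r := Function.leftInverse_invFun hinj r
  have hmk {φ ψ : R → M} {F : Finset S}
      (h : ∀ t, (∀ s ∈ F, s * f t ∈ f.range) → φ t = ψ t) :
      (QuotientAddGroup.mk φ : (R → M) ⧸ vanishing f M) = QuotientAddGroup.mk ψ := by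
    rw [← sub_eq_zero]
    exact (QuotientAddGroup.eq_zero_iff _).2 ⟨F, fun t ht => sub_eq_zero.2 (h t ht)⟩
  classical
  refine ⟨BalancedTensor.lift (AddMonoidHom.mk' (fun m => AddMonoidHom.mk' (fun s =>
    QuotientAddGroup.mk fun t => MulOpposite.op (Function.invFun f (s * f t)) • m) ?_) ?_) ?_,
    fun m s => rfl⟩
  · intro s s'
    refine hmk (F := {s, s'}) fun t ht => ?_
    obtain ⟨r, hr⟩ := ht s (by simp)
    obtain ⟨r', hr'⟩ := ht s' (by simp)
    simp only [add_mul, ← hr, ← hr', ← map_add, hinv, MulOpposite.op_add, add_smul, Pi.add_apply]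
  · intro m m'
    ext s
    exact congrArg _ (funext fun t => smul_add _ _ _)
  · intro m r s
    refine hmk (F := {s}) fun t ht => ?_
    obtain ⟨d, hd⟩ := ht s (by simp)
    change _ • MulOpposite.op r • m = MulOpposite.op (Function.invFun f (f r * s * f t)) • m
    rw [mul_assoc, ← hd, ← map_mul, hinv, hinv, smul_smul, MulOpposite.op_mul]

/-- An element of `M ⊗_R S` can be multiplied by common denominators of the elements of `S`
occurring in it, which moves it into `M`. So it is determined by a germ of functions `R → M`, and
passing to germs preserves injectivity. -/
lemma makesLeftFlat_of_covered_eq_top (hinj : Function.Injective f) (hf : covered f = ⊤) :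
    MakesLeftFlat f := by
  intro M M' _ _ _ _ i hi
  let _ : Module R S := Module.compHom S f
  have hinv (r : R) : Function.invFun f (f r) = r := Function.leftInverse_invFun hinj r
  obtain ⟨Φ, hΦ⟩ := exists_germHom hinj M'
  rw [injective_iff_map_eq_zero]
  intro z hz
  -- `β z s` is the product `z · s` for the action of `S` on the right factor of `M ⊗_R S`
  let β : BalancedTensor R M S →+ S →+ BalancedTensor R M S := BalancedTensor.lift
    (AddMonoidHom.mk' (fun m => (AddMonoidHom.compHom (BalancedTensor.tmul R m)).comp
      AddMonoidHom.mul) fun m m' => by ext; simp) fun m r s => by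
      ext x
      change BalancedTensor.tmul R _ (s * x) = BalancedTensor.tmul R m (f r * s * x)
      rw [BalancedTensor.tmul_smul, mul_assoc]
      rfl
  have hβ (m : M) (s x : S) :
      β (BalancedTensor.tmul R m s) x = BalancedTensor.tmul R m (s * x) := rfl
  have hβ_one (z) : β z 1 = z := by
    induction z using BalancedTensor.induction with
    | zero => simp
    | tmul m s => rw [hβ, mul_one]
    | add x y hx hy => rw [map_add, AddMonoidHom.add_apply, hx, hy]
  have key (z) : ∃ (φ : R → M) (F : Finset S),
      (∀ t, (∀ s ∈ F, s * f t ∈ f.range) → ∀ x, β z (f t * x) = BalancedTensor.tmul R (φ t) x) ∧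
      Φ (BalancedTensor.map i LinearMap.id z) = QuotientAddGroup.mk fun t => i (φ t) := by
    classical
    induction z using BalancedTensor.induction with
    | zero => exact ⟨0, ∅, by simp, by
        simp only [map_zero, Pi.zero_apply]; exact (QuotientAddGroup.mk_zero _).symm⟩
    | tmul m s =>
      refine ⟨fun t => MulOpposite.op (Function.invFun f (s * f t)) • m, {s}, fun t ht x => ?_, ?_⟩
      · obtain ⟨r, hr⟩ := ht s (by simp)
        rw [hβ, ← mul_assoc]
        beta_reduce
        rw [← hr, hinv, BalancedTensor.tmul_smul]
        rfl
      · rw [BalancedTensor.map_tmul, hΦ]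
        exact congrArg _ (funext fun t => (map_smul i _ m).symm)
    | add x y hx hy =>
      obtain ⟨φ, F, h1, h2⟩ := hx
      obtain ⟨ψ, G, h3, h4⟩ := hy
      refine ⟨φ + ψ, F ∪ G, fun t ht x => ?_, ?_⟩
      · rw [map_add, AddMonoidHom.add_apply,
          h1 t (fun s hs => ht s (Finset.mem_union_left _ hs)),
          h3 t (fun s hs => ht s (Finset.mem_union_right _ hs)), Pi.add_apply, map_add]
        rfl
      · rw [map_add, map_add, h2, h4, ← QuotientAddGroup.mk_add]
        exact congrArg _ (funext fun t => (map_add i _ _).symm)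
  obtain ⟨φ, F, h1, h2⟩ := key z
  rw [hz, map_zero, eq_comm, QuotientAddGroup.eq_zero_iff] at h2
  obtain ⟨G, hG⟩ := h2
  classical
  let P : Submodule Sᵐᵒᵖ S :=
    { carrier := {y | ∀ x, β z (y * x) = 0}
      zero_mem' := by simp
      add_mem' := fun ha hb x => by rw [add_mul, map_add, ha, hb, add_zero]
      smul_mem' := fun c y hy x => by
        rw [← MulOpposite.op_unop c, op_smul_eq_mul, mul_assoc]; exact hy _ }
  have hP : (1 : S) ∈ P := by
    refine (generates_commonDenominators hf (F ∪ G)).mem_of_forall_mul_mem fun t ht x => ?_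
    rw [one_mul, h1 t (fun s hs => ht s (Finset.mem_union_left _ hs)),
      hi ((hG t fun s hs => ht s (Finset.mem_union_right _ hs)).trans (map_zero i).symm)]
    simp
  simpa [hβ_one] using hP 1

end Flat

/-! ### The maximal right ring of quotients -/

/-- A homomorphism of right modules from a dense right ideal of `R` to `R`. A right ideal `I` is
dense if `a = 0` whenever `a` is killed by all `r` with `b r ∈ I`, for some `b` in `R`. Only the
values of `toFun` on `dom` matter. -/
structure DenseHom (R : Type u) [Ring R] where
  dom : Submodule Rᵐᵒᵖ R
  dense : ∀ b a : R, (∀ r, b * r ∈ dom → a * r = 0) → a = 0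
  toFun : R → R
  map_add : ∀ x ∈ dom, ∀ y ∈ dom, toFun (x + y) = toFun x + toFun y
  map_mul : ∀ x ∈ dom, ∀ r, toFun (x * r) = toFun x * r

namespace DenseHom

variable {R : Type u} [Ring R]

lemma mul_mem (p : DenseHom R) {x : R} (hx : x ∈ p.dom) (r : R) : x * r ∈ p.dom :=
  p.dom.smul_mem (MulOpposite.op r) hx

/-- Two homomorphisms are identified if they agree where both are defined. This is transitive
because the domains are dense. -/
instance setoid (R : Type u) [Ring R] : Setoid (DenseHom R) where
  r p q := ∀ x ∈ p.dom, x ∈ q.dom → p.toFun x = q.toFun x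
  iseqv :=
    { refl := fun _ _ _ _ => rfl
      symm := fun h x hq hp => (h x hp hq).symm
      trans := fun {p q s} hpq hqs x hp hs => by
        refine sub_eq_zero.1 (q.dense x _ fun r hr => ?_)
        rw [sub_mul, ← p.map_mul x hp, ← s.map_mul x hs, hpq _ (p.mul_mem hp r) hr,
          hqs _ hr (s.mul_mem hs r), sub_self] }

instance : Zero (DenseHom R) where
  zero :=
    { dom := ⊤
      dense := fun _ a h => by simpa using h 1 trivial
      toFun := fun _ => 0
      map_add := by simp
      map_mul := by simp }

instance : One (DenseHom R) where
  one :=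
    { dom := ⊤
      dense := fun _ a h => by simpa using h 1 trivial
      toFun := id
      map_add := by simp
      map_mul := by simp }

instance : Neg (DenseHom R) where
  neg p :=
    { dom := p.dom
      dense := p.dense
      toFun := fun x => -p.toFun x
      map_add := fun x hx y hy => by rw [p.map_add x hx y hy, neg_add]
      map_mul := fun x hx r => by rw [p.map_mul x hx, neg_mul] }

instance : Add (DenseHom R) where
  add p q :=
    { dom := p.dom ⊓ q.dom
      dense := fun b a h => p.dense b a fun r hr => q.dense (b * r) _ fun t ht => by
        rw [mul_assoc] at ht ⊢
        exact h _ ⟨mul_assoc b r t ▸ p.mul_mem hr t, ht⟩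
      toFun := fun x => p.toFun x + q.toFun x
      map_add := fun x hx y hy => by
        rw [p.map_add x hx.1 y hy.1, q.map_add x hx.2 y hy.2, add_add_add_comm]
      map_mul := fun x hx r => by rw [p.map_mul x hx.1, q.map_mul x hx.2, add_mul] }

instance : Mul (DenseHom R) where
  mul p q :=
    { dom :=
        { carrier := {x | x ∈ q.dom ∧ q.toFun x ∈ p.dom}
          zero_mem' := by
            have := q.map_mul 0 q.dom.zero_mem 0
            simp only [mul_zero] at this
            simp [this]
          add_mem' := fun {x y} hx hy =>
            ⟨add_mem hx.1 hy.1, q.map_add x hx.1 y hy.1 ▸ add_mem hx.2 hy.2⟩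
          smul_mem' := fun r x hx =>
            ⟨q.mul_mem hx.1 r.unop, (q.map_mul x hx.1 r.unop).symm ▸ p.mul_mem hx.2 r.unop⟩ }
      dense := fun b a h => q.dense b a fun r hr => p.dense (q.toFun (b * r)) _ fun t ht => by
        rw [mul_assoc]
        refine h _ ⟨mul_assoc b r t ▸ q.mul_mem hr t, ?_⟩
        rwa [← mul_assoc, q.map_mul _ hr]
      toFun := fun x => p.toFun (q.toFun x)
      map_add := fun x hx y hy => by
        rw [q.map_add x hx.1 y hy.1, p.map_add _ hx.2 _ hy.2]
      map_mul := fun x hx r => by rw [q.map_mul x hx.1, p.map_mul _ hx.2] }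

end DenseHom

/-- The maximal right ring of quotients of `R`, whose elements are the germs of homomorphisms from
dense right ideals to `R`, with composition as multiplication. -/
def MaxQuotient (R : Type u) [Ring R] : Type u := Quotient (DenseHom.setoid R)

namespace MaxQuotient

variable {R : Type u} [Ring R]

instance : Zero (MaxQuotient R) := ⟨Quotient.mk _ 0⟩

instance : One (MaxQuotient R) := ⟨Quotient.mk _ 1⟩

instance : Neg (MaxQuotient R) :=
  ⟨Quotient.map (-·) fun _ _ h x hp hq => congrArg Neg.neg (h x hp hq)⟩

instance : Add (MaxQuotient R) :=
  ⟨Quotient.map₂ (· + ·) fun _ _ h _ _ h' x hp hq =>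
    congrArg₂ HAdd.hAdd (h x hp.1 hq.1) (h' x hp.2 hq.2)⟩

instance : Mul (MaxQuotient R) :=
  ⟨Quotient.map₂ (· * ·) fun p₁ p₂ h q₁ q₂ h' x hp hq => by
    have hx : q₁.toFun x = q₂.toFun x := h' x hp.1 hq.1
    change p₁.toFun (q₁.toFun x) = p₂.toFun (q₂.toFun x)
    rw [hx]
    exact h _ (hx ▸ hp.2) hq.2⟩

instance : Ring (MaxQuotient R) where
  add_assoc := by
    rintro ⟨p⟩ ⟨q⟩ ⟨s⟩
    exact Quotient.sound fun x _ _ => add_assoc _ _ _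
  zero_add := by
    rintro ⟨p⟩
    exact Quotient.sound fun x _ _ => zero_add _
  add_zero := by
    rintro ⟨p⟩
    exact Quotient.sound fun x _ _ => add_zero _
  add_comm := by
    rintro ⟨p⟩ ⟨q⟩
    exact Quotient.sound fun x _ _ => add_comm _ _
  neg_add_cancel := by
    rintro ⟨p⟩
    exact Quotient.sound fun x _ _ => neg_add_cancel _
  mul_assoc := by
    rintro ⟨p⟩ ⟨q⟩ ⟨s⟩
    exact Quotient.sound fun x _ _ => rfl
  one_mul := by
    rintro ⟨p⟩
    exact Quotient.sound fun x _ _ => rfl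
  mul_one := by
    rintro ⟨p⟩
    exact Quotient.sound fun x _ _ => rfl
  zero_mul := by
    rintro ⟨p⟩
    exact Quotient.sound fun x _ _ => rfl
  mul_zero := by
    rintro ⟨p⟩
    refine Quotient.sound fun x _ _ => ?_
    have := p.map_mul 0 p.dom.zero_mem 0
    rwa [mul_zero, mul_zero] at this
  left_distrib := by
    rintro ⟨p⟩ ⟨q⟩ ⟨s⟩
    exact Quotient.sound fun x _ h => p.map_add _ h.1.2 _ h.2.2
  right_distrib := by
    rintro ⟨p⟩ ⟨q⟩ ⟨s⟩
    exact Quotient.sound fun x _ _ => rfl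
  nsmul := nsmulRec
  zsmul := zsmulRec

variable {S : Type v} [Ring S] {g : R →+* S}

/-- Left multiplication by `s`, defined on the right ideal of the denominators of `s`, where
`Function.invFun g` takes the product back to `R`. -/
noncomputable def mulLeft (hg : Function.Injective g) (hcov : covered g = ⊤) (s : S) :
    DenseHom R where
  dom :=
    { carrier := {r | s * g r ∈ g.range}
      zero_mem' := ⟨0, by simp⟩
      add_mem' := fun {x y} hx hy => by
        simpa [mul_add] using
          add_mem (show s * g x ∈ g.range from hx) (show s * g y ∈ g.range from hy)
      smul_mem' := fun c x hx => by
        simpa [← mul_assoc] using mul_mem (show s * g x ∈ g.range from hx) ⟨c.unop, rfl⟩ }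
  dense b a h := by
    have : g a = 0 := (mem_covered hcov s b).eq_zero fun t ht => by
      rw [← map_mul, h t ht, map_zero]
    rwa [map_eq_zero_iff g hg] at this
  toFun r := Function.invFun g (s * g r)
  map_add := by
    rintro x ⟨a, ha⟩ y ⟨b, hb⟩
    have hinv := Function.leftInverse_invFun hg
    rw [map_add, mul_add, ← ha, ← hb, ← map_add, hinv, hinv, hinv]
  map_mul := by
    rintro x ⟨a, ha⟩ r
    have hinv := Function.leftInverse_invFun hg
    rw [map_mul, ← mul_assoc, ← ha, ← map_mul, hinv, hinv]

lemma apply_mulLeft (hg : Function.Injective g) (hcov : covered g = ⊤) {s : S} {x : R}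
    (hx : x ∈ (mulLeft hg hcov s).dom) : g ((mulLeft hg hcov s).toFun x) = s * g x :=
  Function.invFun_eq hx

/-- The embedding into the maximal right ring of quotients of an extension of `R` in which the
denominators of each element generate the unit right ideal. -/
noncomputable def embed (hg : Function.Injective g) (hcov : covered g = ⊤) :
    S →+* MaxQuotient R where
  toFun s := Quotient.mk _ (mulLeft hg hcov s)
  map_one' := Quotient.sound fun x hx _ => hg <| by
    rw [apply_mulLeft hg hcov hx, one_mul]; rfl
  map_mul' s t := Quotient.sound fun x hx hx' => hg <| by
    change _ = g ((mulLeft hg hcov s).toFun ((mulLeft hg hcov t).toFun x))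
    rw [apply_mulLeft hg hcov hx, apply_mulLeft hg hcov hx'.2, apply_mulLeft hg hcov hx'.1,
      mul_assoc]
  map_zero' := Quotient.sound fun x hx _ => hg <| by
    rw [apply_mulLeft hg hcov hx, zero_mul]; exact (map_zero g).symm
  map_add' s t := Quotient.sound fun x hx hx' => hg <| by
    change _ = g ((mulLeft hg hcov s).toFun x + (mulLeft hg hcov t).toFun x)
    rw [apply_mulLeft hg hcov hx, map_add, apply_mulLeft hg hcov hx'.1,
      apply_mulLeft hg hcov hx'.2, add_mul]

lemma embed_injective (hg : Function.Injective g) (hcov : covered g = ⊤) :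
    Function.Injective (embed hg hcov) := by
  rw [injective_iff_map_eq_zero]
  intro s hs
  refine (mem_covered hcov s 1).eq_zero fun t ht => ?_
  rw [Set.mem_ofPred_eq, one_mul] at ht
  have : (mulLeft hg hcov s).toFun t = 0 := Quotient.exact hs t ht trivial
  rw [← apply_mulLeft hg hcov ht, this, map_zero]

lemma covered_id : covered (RingHom.id R) = ⊤ :=
  eq_top_iff.2 fun _ _ _ => .of_one_mem (by simp)

variable (R) in
/-- The embedding of `R` into its maximal right ring of quotients. -/
noncomputable def ofRing : R →+* MaxQuotient R :=
  embed (g := RingHom.id R) Function.injective_id covered_id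

lemma embed_comp (hg : Function.Injective g) (hcov : covered g = ⊤) :
    (embed hg hcov).comp g = ofRing R :=
  RingHom.ext fun a => Quotient.sound fun x hx hx' => hg <| by
    rw [apply_mulLeft hg hcov hx, ← map_mul]
    exact congrArg g (apply_mulLeft (g := RingHom.id R) Function.injective_id covered_id hx').symm

end MaxQuotient

/-! ### The total symmetric ring of quotients -/

section Total

variable {R : Type u} [Ring R]

/-- The denominators of each element of `S`, on the left and on the right, generate `S`. For
injective `f : R → S`, this characterizes the epimorphisms that are flat on both sides. -/
def IsTwoSidedCovered {S : Type v} [Ring S] (f : R →+* S) : Prop :=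
  covered f = ⊤ ∧ covered (RingHom.op f) = ⊤

variable (R) in
/-- The total symmetric ring of quotients of `R`: the subring of the maximal right ring of quotients
generated by all intermediate rings `W ⊇ R` such that the denominators of each element of `W`, on
the left and on the right, generate `W`. -/
noncomputable def totalQuotient : Subring (MaxQuotient R) :=
  sSup {W | ∃ k : R →+* W, W.subtype.comp k = MaxQuotient.ofRing R ∧ IsTwoSidedCovered k}


namespace IsTwoSidedCovered

variable {S : Type v} [Ring S] {T : Type w} [Ring T] {g : R →+* S}

lemma comp_of_surjective (hg : IsTwoSidedCovered g) {k : S →+* T} (hk : Function.Surjective k) :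
    IsTwoSidedCovered (k.comp g) := by
  constructor
  · refine eq_top_iff.2 fun t _ => ?_
    obtain ⟨s, rfl⟩ := hk t
    exact map_mem_covered (mem_covered hg.1 s) k
  · refine eq_top_iff.2 fun t _ => ?_
    obtain ⟨s, hs⟩ := hk t.unop
    rw [← MulOpposite.op_unop t, ← hs]
    exact map_mem_covered (mem_covered hg.2 (MulOpposite.op s)) (RingHom.op k)

lemma id : IsTwoSidedCovered (RingHom.id R) :=
  ⟨MaxQuotient.covered_id, MaxQuotient.covered_id (R := Rᵐᵒᵖ)⟩

lemma embed_mem_totalQuotient (hinj : Function.Injective g) (hg : IsTwoSidedCovered g) (s : S) :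
    MaxQuotient.embed hinj hg.1 s ∈ totalQuotient R := by
  refine (le_sSup ?_ : (MaxQuotient.embed hinj hg.1).range ≤ _) ⟨s, rfl⟩
  exact ⟨(MaxQuotient.embed hinj hg.1).rangeRestrict.comp g, MaxQuotient.embed_comp hinj hg.1,
    hg.comp_of_surjective (RingHom.rangeRestrict_surjective _)⟩

/-- The embedding into the total symmetric ring of quotients of an extension of `R` in which the
denominators of each element generate the unit ideal on both sides. -/
noncomputable def toTotalQuotient (hinj : Function.Injective g) (hg : IsTwoSidedCovered g) :
    S →+* totalQuotient R :=
  (MaxQuotient.embed hinj hg.1).codRestrict _ (hg.embed_mem_totalQuotient hinj)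

lemma toTotalQuotient_injective (hinj : Function.Injective g) (hg : IsTwoSidedCovered g) :
    Function.Injective (hg.toTotalQuotient hinj) := fun _ _ h =>
  MaxQuotient.embed_injective hinj hg.1 (congrArg Subtype.val h)

end IsTwoSidedCovered

variable (R) in
/-- The embedding of `R` into its total symmetric ring of quotients. -/
noncomputable def toTotal : R →+* totalQuotient R :=
  IsTwoSidedCovered.id.toTotalQuotient Function.injective_id

lemma IsTwoSidedCovered.toTotalQuotient_comp {S : Type v} [Ring S] {g : R →+* S}
    (hinj : Function.Injective g) (hg : IsTwoSidedCovered g) :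
    (hg.toTotalQuotient hinj).comp g = toTotal R :=
  RingHom.ext fun r => Subtype.ext (RingHom.congr_fun (MaxQuotient.embed_comp hinj hg.1) r)

/-- The covered elements form a subring, so it suffices that the rings generating
`totalQuotient R` consist of covered elements. -/
lemma isTwoSidedCovered_toTotal : IsTwoSidedCovered (toTotal R) := by
  have hle : ∀ W ∈ {W : Subring (MaxQuotient R) |
      ∃ k : R →+* W, W.subtype.comp k = MaxQuotient.ofRing R ∧ IsTwoSidedCovered k},
      ∀ w ∈ W, ∃ q : totalQuotient R, (q : MaxQuotient R) = w ∧ q ∈ covered (toTotal R) ∧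
        MulOpposite.op q ∈ covered (RingHom.op (toTotal R)) := by
    rintro W hW w hw
    obtain ⟨k, hk, hcov⟩ := id hW
    let ι := Subring.inclusion (le_sSup hW : W ≤ totalQuotient R)
    have hι : ι.comp k = toTotal R :=
      RingHom.ext fun r => Subtype.ext (RingHom.congr_fun hk r)
    refine ⟨ι ⟨w, hw⟩, rfl, ?_, ?_⟩
    · rw [← hι]
      exact map_mem_covered (mem_covered hcov.1 _) ι
    · rw [← hι]
      exact map_mem_covered (mem_covered hcov.2 (MulOpposite.op ⟨w, hw⟩)) (RingHom.op ι)
  constructor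
  · have : totalQuotient R ≤ (covered (toTotal R)).map (totalQuotient R).subtype :=
      sSup_le fun W hW w hw => by
        obtain ⟨q, rfl, hq, -⟩ := hle W hW w hw
        exact ⟨q, hq, rfl⟩
    refine eq_top_iff.2 fun q _ => ?_
    obtain ⟨q', hq', h⟩ := this q.2
    exact Subtype.ext h ▸ hq'
  · have : totalQuotient R ≤
        (covered (RingHom.op (toTotal R))).unop.map (totalQuotient R).subtype :=
      sSup_le fun W hW w hw => by
        obtain ⟨q, rfl, -, hq⟩ := hle W hW w hw
        exact ⟨q, hq, rfl⟩
    refine eq_top_iff.2 fun q _ => ?_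
    obtain ⟨q', hq', h⟩ := this q.unop.2
    have hqq : q' = q.unop := Subtype.ext h
    rw [← MulOpposite.op_unop q, ← hqq]
    exact hq'

end Total

end NCRing

theorem mainTheorem4 (R : Type u) [Ring R] :
    ∃ (Q : Type u) (_ : Ring Q) (f : R →+* Q),
      Function.Injective f ∧ NCRing.IsRingEpi f ∧
      NCRing.MakesLeftFlat f ∧ NCRing.MakesRightFlat f ∧
      ∀ (S : Type v) [Ring S] (g : R →+* S),
        Function.Injective g → NCRing.IsRingEpi g →
        NCRing.MakesLeftFlat g → NCRing.MakesRightFlat g →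
        ∃! gbar : S →+* Q, Function.Injective gbar ∧ gbar.comp g = f := by
  have hcov := NCRing.isTwoSidedCovered_toTotal (R := R)
  have hinj : Function.Injective (NCRing.toTotal R) :=
    NCRing.IsTwoSidedCovered.toTotalQuotient_injective _ _
  have hinj_op : Function.Injective (RingHom.op (NCRing.toTotal R)) := fun a b h =>
    MulOpposite.unop_injective (hinj (congrArg MulOpposite.unop h))
  refine ⟨NCRing.totalQuotient R, inferInstance, NCRing.toTotal R, hinj,
    NCRing.isRingEpi_of_covered_eq_top hcov.1,
    NCRing.makesLeftFlat_of_covered_eq_top hinj hcov.1,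
    NCRing.makesRightFlat_iff_op.2 (NCRing.makesLeftFlat_of_covered_eq_top hinj_op hcov.2), ?_⟩
  intro S _ g hg hepi hleft hright
  have hgcov : NCRing.IsTwoSidedCovered g :=
    ⟨hepi.covered_eq_top hleft, hepi.op.covered_eq_top (NCRing.makesRightFlat_iff_op.1 hright)⟩
  refine ⟨hgcov.toTotalQuotient hg, ⟨hgcov.toTotalQuotient_injective hg,
    hgcov.toTotalQuotient_comp hg⟩, fun k hk => ?_⟩
  exact NCRing.eq_of_comp_eq hgcov.1 (hk.2.trans (hgcov.toTotalQuotient_comp hg).symm)
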